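/- Let $G$ be a finite simple undirected graph with $n \ge 3$ vertices and $e$ edges, with minimum degree $\delta$ and maximum degree $\Delta$, and let $M_1(G) = \sum_{u \in V(G)} d_G(u)^2$ be its first Zagreb index. Let $k \ge 2$ be an integer and suppose that $G$ is $k$-connected, that is, $n > k$ and deleting any set of fewer than $k$ vertices leaves a connected graph. If $$M_1(G) \ge (n-k-1)\Delta^2 + \frac{\bigl(e(\delta+n-k-1)\bigr)^2}{4\delta(n-k-1)(k+1)},$$ then $G$ has a Hamiltonian cycle or $G$ is isomorphic to the complete bipartite graph $K_{k,k+1}$. (In the degenerate case $n = k+1$, where $G$ is complete, the fraction is read as $0$.) -/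

import Mathlib

/-- `G` is `k`-connected (in the sense of vertex connectivity): it has more than `k` vertices, and
deleting any set of fewer than `k` vertices leaves a connected graph. -/
def SimpleGraph.IsKConnected {V : Type*} [Fintype V] (G : SimpleGraph V) (k : ℕ) : Prop :=
  k < Fintype.card V ∧
    ∀ S : Finset V, S.card < k → (G.induce ((S : Set V)ᶜ)).Connected

/-- The first Zagreb index of `G`: the sum of the squares of the degrees of its vertices. -/
def SimpleGraph.firstZagrebIndex {V : Type*} [Fintype V] (G : SimpleGraph V)
    [DecidableRel G.Adj] : ℕ :=
  ∑ u : V, G.degree u ^ 2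

/-! If `G` is not Hamiltonian, Chvátal–Erdős gives an independent set `S` of `k + 1` vertices, with
complement of size `N = n - k - 1`. Degrees on `S` lie in `[δ, N]` and sum to `D ≤ e`. Put `Q = ∑_S
d²` and `c = (k + 1)δN`. Summing `(d - δ)(N - d) ≥ 0` over `S` gives `Q + c ≤ (δ + N)e`, and `4cQ ≤
(Q + c)²` bounds `Q` by the fraction. The complement contributes at most `NΔ²`, so the hypothesis
forces equality everywhere (`eq_of_add_sq_div_le`). Equality makes both sides independent, the
degrees off `S` equal to `Δ`, and then all degrees on `S` equal to `N`. So `G` is `K_{N,k+1}` with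
`N` equal to `k` or `k + 1`, and the balanced graph is Hamiltonian. -/

namespace SimpleGraph

variable {V : Type*} {G : SimpleGraph V}

/-! ### Cycles as vertex lists -/

/-- `l` lists the vertices of a cycle of `G` in order; an edge counts as a cycle of length two. -/
def IsCycleList (G : SimpleGraph V) (l : List V) : Prop :=
  l.Nodup ∧ l.IsChain G.Adj ∧ ∀ x ∈ l.getLast?, ∀ y ∈ l.head?, G.Adj x y

theorem IsCycleList.append_comm {a b : List V} (h : G.IsCycleList (a ++ b)) :
    G.IsCycleList (b ++ a) := by
  rcases eq_or_ne a [] with rfl | ha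
  · simpa using h
  rcases eq_or_ne b [] with rfl | hb
  · simpa using h
  obtain ⟨h1, h2, h3⟩ := h
  rw [List.isChain_append] at h2
  refine ⟨List.nodup_append_comm.mp h1, ?_, ?_⟩
  · rw [List.isChain_append]
    refine ⟨h2.2.1, h2.1, ?_⟩
    rwa [List.getLast?_append_of_ne_nil _ hb, List.head?_append_of_ne_nil _ ha] at h3
  · rw [List.getLast?_append_of_ne_nil _ ha, List.head?_append_of_ne_nil _ hb]
    exact h2.2.2

theorem IsCycleList.append {l p : List V} (h : G.IsCycleList l) (hl : l ≠ []) (hp : p ≠ [])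
    (hpn : p.Nodup) (hpc : p.IsChain G.Adj) (hd : ∀ x ∈ p, x ∉ l)
    (h1 : ∀ x ∈ l.getLast?, ∀ y ∈ p.head?, G.Adj x y)
    (h2 : ∀ x ∈ p.getLast?, ∀ y ∈ l.head?, G.Adj x y) :
    G.IsCycleList (l ++ p) := by
  refine ⟨?_, ?_, ?_⟩
  · rw [List.nodup_append']
    exact ⟨h.1, hpn, fun x hx hx' => hd x hx' hx⟩
  · rw [List.isChain_append]
    exact ⟨h.2.1, hpc, h1⟩
  · rwa [List.getLast?_append_of_ne_nil _ hp, List.head?_append_of_ne_nil _ hl]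

/-- Reroute a cycle `a ++ b` through the chord joining the heads of `a` and `b` and a detour `p`
joining their last vertices. -/
theorem IsCycleList.reroute {a b p : List V} (h : G.IsCycleList (a ++ b)) (ha : a ≠ [])
    (hb : b ≠ []) (hp : p ≠ []) (hpn : p.Nodup) (hpc : p.IsChain G.Adj)
    (hd : ∀ x ∈ p, x ∉ a ++ b)
    (hab : ∀ x ∈ a.head?, ∀ y ∈ b.head?, G.Adj x y)
    (hbp : ∀ x ∈ b.getLast?, ∀ y ∈ p.head?, G.Adj x y)
    (hpa : ∀ x ∈ p.getLast?, ∀ y ∈ a.getLast?, G.Adj x y) :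
    G.IsCycleList (a.reverse ++ b ++ p) := by
  obtain ⟨h1, h2, -⟩ := h
  have hra : a.reverse ≠ [] := by simpa using ha
  rw [List.isChain_append] at h2
  rw [List.nodup_append'] at h1
  refine ⟨?_, ?_, ?_⟩
  · rw [List.nodup_append', List.nodup_append']
    refine ⟨⟨List.nodup_reverse.mpr h1.1, h1.2.1, ?_⟩, hpn, ?_⟩
    · intro x hx
      exact h1.2.2 (List.mem_reverse.mp hx)
    · intro x hx hx'
      exact hd x hx' (by simpa using hx)
  · rw [List.isChain_append, List.isChain_append]
    refine ⟨⟨?_, h2.2.1, ?_⟩, hpc, ?_⟩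
    · rw [List.isChain_reverse]
      exact h2.1.imp fun _ _ h => h.symm
    · simpa using hab
    · rwa [List.getLast?_append_of_ne_nil _ hb]
  · rw [List.getLast?_append_of_ne_nil _ hp, List.append_assoc, List.head?_append_of_ne_nil _ hra]
    simpa using hpa

theorem IsCycleList.isHamiltonian [Fintype V] [DecidableEq V] {l : List V} (h : G.IsCycleList l)
    (hn : 3 ≤ Fintype.card V) (hmem : ∀ v, v ∈ l) : G.IsHamiltonian := by
  intro _
  obtain ⟨h1, h2, h3⟩ := h
  have hlen : l.length = Fintype.card V := by
    rw [← List.toFinset_card_of_nodup h1, ← Finset.card_univ]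
    congr 1
    ext v
    simp [hmem]
  have hne : l ≠ [] := by
    rintro rfl
    simp at hlen
    omega
  have hadj : G.Adj (l.getLast hne) (l.head hne) :=
    h3 _ (List.getLast_mem_getLast? hne) _ (List.head_mem_head? hne)
  have hpath : (Walk.ofSupport l hne h2).IsPath := by
    rw [Walk.isPath_def, Walk.support_ofSupport]
    exact h1
  have hl := Walk.length_ofSupport hne h2
  refine ⟨_, Walk.cons hadj (Walk.ofSupport l hne h2), ?_⟩
  rw [Walk.isHamiltonianCycle_iff_isCycle_and_length_eq, Walk.cons_isCycle_iff]
  refine ⟨⟨hpath, fun hm => ?_⟩, ?_⟩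
  -- With at least three vertices, the closing edge cannot already lie on the path.
  · rw [Sym2.eq_swap] at hm
    have := hpath.length_eq_one_of_mem_edges hm
    omega
  · rw [Walk.length_cons]
    omega

theorem exists_list_of_reachable_induce {s : Set V} {a b : s} (h : (G.induce s).Reachable a b) :
    ∃ p : List V, p.Nodup ∧ p.IsChain G.Adj ∧ (∀ x ∈ p, x ∈ s) ∧
      p.head? = some (a : V) ∧ p.getLast? = some (b : V) := by
  obtain ⟨w, hw⟩ := h.exists_isPath
  refine ⟨w.support.map Subtype.val, ?_, ?_, ?_, ?_, ?_⟩
  · exact (List.nodup_map_iff Subtype.val_injective).mpr hw.support_nodup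
  · rw [List.isChain_map]
    exact w.isChain_adj_support.imp fun _ _ h => h
  · simp +contextual
  · rw [List.head?_map, List.head?_eq_some_head w.support_ne_nil, Walk.head_support]
    rfl
  · rw [List.getLast?_map, List.getLast?_eq_some_getLast w.support_ne_nil, Walk.getLast_support]
    rfl

/-! ### Lengthening a cycle by a detour -/

/-- The successor of `x` along a cycle that is cut open after `x`. -/
theorem formPerm_eq_of_cut [DecidableEq V] {l s t : List V} {x y : V} (hl : l.Nodup)
    (h : l = s ++ x :: t) (hy : (t ++ s ++ [x]).head? = some y) :
    l.formPerm x = y := by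
  have hr : l ~r t ++ (s ++ [x]) := by
    rw [h, List.append_cons]
    exact List.isRotated_append
  rw [List.formPerm_eq_of_isRotated hl hr, ← List.append_assoc]
  rcases hts : t ++ s with _ | ⟨z, r⟩
  · rw [hts] at hy
    simp at hy
    simp [hy]
  · rw [hts] at hy
    simp at hy
    rw [List.cons_append, List.formPerm_cons_concat_apply_last, hy]

/-- The edge from `x` to its successor is replaced by the detour `p`. -/
theorem IsCycleList.length_lt_of_formPerm_adj [DecidableEq V] {l p : List V} {x a b : V}
    (h : G.IsCycleList l) (hx : x ∈ l) (hpn : p.Nodup) (hpc : p.IsChain G.Adj)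
    (hd : ∀ z ∈ p, z ∉ l) (ha : p.head? = some a) (hb : p.getLast? = some b)
    (hxa : G.Adj x a) (hyb : G.Adj (l.formPerm x) b) :
    ∃ m, G.IsCycleList m ∧ l.length < m.length := by
  obtain ⟨s, t, hst⟩ := List.append_of_mem hx
  have hp : p ≠ [] := by rintro rfl; simp at ha
  obtain ⟨y, hy⟩ : ∃ y, (t ++ s ++ [x]).head? = some y :=
    ⟨_, List.head?_eq_some_head (by simp)⟩
  rw [formPerm_eq_of_cut h.1 hst hy] at hyb
  have hm : G.IsCycleList (t ++ s ++ [x]) := by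
    rw [List.append_assoc]
    apply IsCycleList.append_comm
    simpa [hst] using h
  refine ⟨_, hm.append (by simp) hp hpn hpc ?_ ?_ ?_, ?_⟩
  · intro z hz hz'
    apply hd z hz
    rw [hst]
    simp at hz' ⊢
    tauto
  · rw [ha]
    simpa using hxa
  · rw [hb, hy]
    simpa using hyb.symm
  · have := List.length_pos_of_ne_nil hp
    rw [hst]
    simp
    omega

/-- Cutting after `x` and after `x'` leaves two arcs. The chord joins their first vertices and `p`
joins their last ones, so reversing one arc closes a longer cycle. -/
theorem IsCycleList.length_lt_of_formPerm_adj_formPerm [DecidableEq V] {l p : List V}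
    {x x' a b : V} (h : G.IsCycleList l) (hx : x ∈ l) (hx' : x' ∈ l) (hne : x ≠ x')
    (hpn : p.Nodup) (hpc : p.IsChain G.Adj)
    (hd : ∀ z ∈ p, z ∉ l) (ha : p.head? = some a) (hb : p.getLast? = some b)
    (hxa : G.Adj x a) (hxb : G.Adj x' b) (hadj : G.Adj (l.formPerm x) (l.formPerm x')) :
    ∃ m, G.IsCycleList m ∧ l.length < m.length := by
  obtain ⟨s, t, hst⟩ := List.append_of_mem hx
  have hp : p ≠ [] := by rintro rfl; simp at ha
  have hmem : x' ∈ t ++ s := by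
    rw [hst] at hx'
    simp at hx' ⊢
    tauto
  obtain ⟨s', t', hst'⟩ := List.append_of_mem hmem
  have hr : l ~r (s' ++ [x']) ++ (t' ++ [x]) := by
    have : l ~r t ++ (s ++ [x]) := by
      rw [hst, List.append_cons]
      exact List.isRotated_append
    rw [← List.append_assoc, hst'] at this
    simpa using this
  have hm : G.IsCycleList ((s' ++ [x']) ++ (t' ++ [x])) := by
    have : G.IsCycleList (t ++ (s ++ [x])) := by
      apply IsCycleList.append_comm
      simpa [hst] using h
    rw [← List.append_assoc, hst'] at this
    simpa using this
  obtain ⟨y, hy⟩ : ∃ y, (s' ++ [x']).head? = some y :=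
    ⟨_, List.head?_eq_some_head (by simp)⟩
  obtain ⟨z, hz⟩ : ∃ z, (t' ++ [x]).head? = some z :=
    ⟨_, List.head?_eq_some_head (by simp)⟩
  have hy' : l.formPerm x = y := by
    apply formPerm_eq_of_cut h.1 hst
    rw [hst', List.append_cons s', List.append_assoc,
      List.head?_append_of_ne_nil _ (by simp), hy]
  have hz' : l.formPerm x' = z := by
    rw [List.formPerm_eq_of_isRotated h.1 hr]
    apply formPerm_eq_of_cut hm.1 (s := s') (t := t' ++ [x]) (by simp)
    rw [List.append_assoc, List.head?_append_of_ne_nil _ (by simp), hz]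
  rw [hy', hz'] at hadj
  refine ⟨_, hm.reroute (by simp) (by simp) hp hpn hpc ?_ ?_ ?_ ?_, ?_⟩
  · intro w hw hw'
    exact hd w hw (hr.mem_iff.mpr hw')
  · rw [hy, hz]
    simpa using hadj
  · rw [ha]
    simpa using hxa
  · rw [hb]
    simpa using hxb.symm
  · have := List.length_pos_of_ne_nil hp
    rw [hr.perm.length_eq]
    simp
    omega

/-! ### Connectivity and the Chvátal–Erdős theorem -/

/-- The vertices that can be reached from `v` without meeting `l`. -/
def reachableAvoiding (G : SimpleGraph V) (l : List V) (v : V) : Set V :=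
  {w | ∃ (hv : v ∈ {x | x ∉ l}) (hw : w ∈ {x | x ∉ l}),
    (G.induce {x | x ∉ l}).Reachable ⟨v, hv⟩ ⟨w, hw⟩}

theorem exists_list_of_mem_reachableAvoiding {l : List V} {v a b : V}
    (ha : a ∈ G.reachableAvoiding l v) (hb : b ∈ G.reachableAvoiding l v) :
    ∃ p : List V, p.Nodup ∧ p.IsChain G.Adj ∧ (∀ x ∈ p, x ∉ l) ∧
      p.head? = some a ∧ p.getLast? = some b := by
  obtain ⟨_, _, h1⟩ := ha
  obtain ⟨_, _, h2⟩ := hb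
  exact exists_list_of_reachable_induce (h1.symm.trans h2)

theorem mem_reachableAvoiding_of_adj {l : List V} {v a b : V}
    (ha : a ∈ G.reachableAvoiding l v) (hb : b ∉ l) (hab : G.Adj a b) :
    b ∈ G.reachableAvoiding l v := by
  obtain ⟨hv, _, h1⟩ := ha
  refine ⟨hv, hb, h1.trans ?_⟩
  exact Adj.reachable (G := G.induce {x | x ∉ l}) hab

/-- A set closed under adjacency outside `S` contains everything outside `S` once `G - S` is
connected and it contains a vertex outside `S`. -/
theorem mem_of_connected_induce {S K : Set V} (hS : (G.induce Sᶜ).Connected)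
    (hK : ∀ a ∈ K, ∀ b ∉ S, G.Adj a b → b ∈ K) {v y : V} (hvK : v ∈ K) (hv : v ∉ S)
    (hy : y ∉ S) : y ∈ K := by
  obtain ⟨w⟩ := hS.preconnected ⟨v, hv⟩ ⟨y, hy⟩
  have : ∀ {a b : (Sᶜ : Set V)} (_ : (G.induce Sᶜ).Walk a b), (a : V) ∈ K → (b : V) ∈ K := by
    intro a b w
    induction w with
    | nil => exact id
    | @cons a b c h _ ih => exact fun ha => ih (hK _ ha _ b.2 h)
  exact this w hvK

/-- Deleting fewer than `k` neighbours would isolate `v`, so `v` and its neighbours would be all of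
`V`, at most `k` vertices. -/
theorem IsKConnected.le_degree [Fintype V] {k : ℕ} (h : G.IsKConnected k) (v : V)
    [Fintype (G.neighborSet v)] : k ≤ G.degree v := by
  classical
  by_contra! hlt
  have hc := h.2 (G.neighborFinset v) hlt
  have hsub : (Finset.univ : Finset V) ⊆ insert v (G.neighborFinset v) := by
    intro y _
    by_contra hy
    rw [Finset.mem_insert, not_or] at hy
    have : y ∈ ({v} : Set V) := by
      refine mem_of_connected_induce hc ?_ (Set.mem_singleton v) (by simp) (by simpa using hy.2)
      rintro a rfl b hb hab
      simp [hab] at hb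
    exact hy.1 this
  have h1 := Finset.card_le_card hsub
  have h2 := Finset.card_insert_le v (G.neighborFinset v)
  rw [Finset.card_univ] at h1
  rw [card_neighborFinset_eq_degree] at h2
  have := h.1
  omega

/-- **Chvátal–Erdős theorem**: a `k`-connected graph without `k + 1` independent vertices is
Hamiltonian. -/
theorem IsKConnected.exists_isIndepSet_of_not_isHamiltonian [Fintype V] [DecidableEq V] {k : ℕ}
    (h : G.IsKConnected k) (hk : 1 ≤ k) (hn : 3 ≤ Fintype.card V) (hG : ¬ G.IsHamiltonian) :
    ∃ I : Finset V, I.card = k + 1 ∧ G.IsIndepSet (I : Set V) := by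
  classical
  obtain ⟨u⟩ : Nonempty V := Fintype.card_pos_iff.mp (by omega)
  obtain ⟨u', hu⟩ : ∃ u', G.Adj u u' := by
    rw [← degree_pos_iff_exists_adj]
    exact lt_of_lt_of_le hk (h.le_degree u)
  have hedge : G.IsCycleList [u, u'] := by
    refine ⟨by simpa using hu.ne, by simpa using hu, by simpa using hu.symm⟩
  -- A longest cycle; a single edge, of length two, ensures that one exists.
  obtain ⟨l, ⟨hl, hl2⟩, hmax⟩ : ∃ l, (G.IsCycleList l ∧ 2 ≤ l.length) ∧
      ∀ m, G.IsCycleList m → m.length ≤ l.length := by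
    have hfin : {i | ∃ l, G.IsCycleList l ∧ l.length = i}.Finite := by
      refine (Set.finite_Iic (Fintype.card V)).subset ?_
      rintro _ ⟨l, hl, rfl⟩
      exact hl.1.length_le_card
    obtain ⟨i, ⟨l, hl, rfl⟩, hi⟩ := hfin.exists_maximal ⟨_, _, hedge, rfl⟩
    have hmax : ∀ m, G.IsCycleList m → m.length ≤ l.length := by
      intro m hm
      by_contra! hlt
      exact absurd (hi ⟨m, hm, rfl⟩ hlt.le) (by simpa using hlt)
    exact ⟨l, ⟨hl, by simpa using hmax _ hedge⟩, hmax⟩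
  obtain ⟨v, hv⟩ : ∃ v, v ∉ l := by
    by_contra! hall
    exact hG (hl.isHamiltonian hn hall)
  -- `K` is the component of `v` off the cycle and `A` its set of attachments. The independent set
  -- will consist of `v` and successors of `A`.
  set K := G.reachableAvoiding l v with hK
  have hvK : v ∈ K := ⟨hv, hv, Reachable.refl _⟩
  set A : Finset V := l.toFinset.filter fun x => ∃ w ∈ K, G.Adj x w with hA
  have hAl : ∀ {x}, x ∈ A ↔ x ∈ l ∧ ∃ w ∈ K, G.Adj x w := by simp [hA]
  have hsucc : ∀ x ∈ A, l.formPerm x ∉ A := by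
    intro x hx hy
    obtain ⟨hxl, a, haK, hxa⟩ := hAl.mp hx
    obtain ⟨-, b, hbK, hyb⟩ := hAl.mp hy
    obtain ⟨p, hpn, hpc, hd, ha, hb⟩ := exists_list_of_mem_reachableAvoiding haK hbK
    obtain ⟨m, hm, hlt⟩ := hl.length_lt_of_formPerm_adj hxl hpn hpc hd ha hb hxa hyb
    exact absurd (hmax m hm) (by omega)
  have hindep : ∀ x ∈ A, ∀ x' ∈ A, ¬ G.Adj (l.formPerm x) (l.formPerm x') := by
    intro x hx x' hx' hadj
    obtain ⟨hxl, a, haK, hxa⟩ := hAl.mp hx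
    obtain ⟨hxl', b, hbK, hxb⟩ := hAl.mp hx'
    obtain ⟨p, hpn, hpc, hd, ha, hb⟩ := exists_list_of_mem_reachableAvoiding haK hbK
    have hne : x ≠ x' := by
      rintro rfl
      exact hadj.ne rfl
    obtain ⟨m, hm, hlt⟩ :=
      hl.length_lt_of_formPerm_adj_formPerm hxl hxl' hne hpn hpc hd ha hb hxa hxb hadj
    exact absurd (hmax m hm) (by omega)
  -- Otherwise deleting `A` leaves a connected graph, yet `A` separates `K` from a cycle vertex
  -- outside `A`, such as the successor of an attachment.
  have hAcard : k ≤ A.card := by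
    by_contra! hlt
    obtain ⟨y, hyl, hyA⟩ : ∃ y ∈ l, y ∉ A := by
      rcases A.eq_empty_or_nonempty with hAe | ⟨x, hx⟩
      · rw [hAe]
        exact ⟨l.head (List.ne_nil_of_length_pos (by omega)), List.head_mem _, by simp⟩
      · exact ⟨_, List.formPerm_apply_mem_of_mem (hAl.mp hx).1, hsucc x hx⟩
    have hyK : y ∈ K := by
      refine mem_of_connected_induce (h.2 A hlt) ?_ hvK ?_ (by simpa using hyA)
      · intro a ha b hb hab
        refine mem_reachableAvoiding_of_adj ha (fun hbl => hb ?_) hab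
        exact Finset.mem_coe.mpr (hAl.mpr ⟨hbl, a, ha, hab.symm⟩)
      · exact fun hvA => hv (hAl.mp (Finset.mem_coe.mp hvA)).1
    obtain ⟨_, hy, _⟩ := hyK
    exact hy hyl
  have hvsucc : v ∉ A.map l.formPerm.toEmbedding := by
    rw [Finset.mem_map]
    rintro ⟨x, hx, hxv⟩
    exact hv (hxv ▸ List.formPerm_apply_mem_of_mem (hAl.mp hx).1)
  obtain ⟨I, hI, hIcard⟩ : ∃ I ⊆ insert v (A.map l.formPerm.toEmbedding), I.card = k + 1 := by
    apply Finset.exists_subset_card_eq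
    rw [Finset.card_insert_of_notMem hvsucc, Finset.card_map]
    omega
  have hvA : ∀ x ∈ A, ¬ G.Adj v (l.formPerm x) := by
    intro x hx hadj
    exact hsucc x hx
      (hAl.mpr ⟨List.formPerm_apply_mem_of_mem (hAl.mp hx).1, v, hvK, hadj.symm⟩)
  refine ⟨I, hIcard, ?_⟩
  intro x hx y hy _ hadj
  have hx' := hI (Finset.mem_coe.mp hx)
  have hy' := hI (Finset.mem_coe.mp hy)
  simp only [Finset.mem_insert, Finset.mem_map, Equiv.coe_toEmbedding] at hx' hy'
  rcases hx' with rfl | ⟨a, ha, rfl⟩ <;> rcases hy' with rfl | ⟨b, hb, rfl⟩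
  · exact hadj.ne rfl
  · exact hvA _ hb hadj
  · exact hvA _ ha hadj.symm
  · exact hindep _ ha _ hb hadj

/-! ### Counting edges across an independent set -/

section BipartiteCount

variable [Fintype V] [DecidableEq V] [DecidableRel G.Adj] {S : Finset V}

theorem IsIndepSet.neighborFinset_subset_compl (hS : G.IsIndepSet (S : Set V)) {x : V}
    (hx : x ∈ S) : G.neighborFinset x ⊆ Sᶜ := by
  intro y hy
  rw [mem_neighborFinset] at hy
  exact Finset.mem_compl.mpr fun hyS => hS hx hyS hy.ne hy

theorem IsIndepSet.degree_le_card_compl (hS : G.IsIndepSet (S : Set V)) {x : V} (hx : x ∈ S) :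
    G.degree x ≤ Sᶜ.card :=
  Finset.card_le_card (hS.neighborFinset_subset_compl hx)

/-- Both sides count the edges between `S` and its complement. -/
theorem IsIndepSet.sum_degree_eq (hS : G.IsIndepSet (S : Set V)) :
    ∑ x ∈ S, G.degree x = ∑ y ∈ Sᶜ, (G.neighborFinset y ∩ S).card := by
  have h := Finset.sum_card_bipartiteAbove_eq_sum_card_bipartiteBelow (s := S) (t := Sᶜ) G.Adj
  convert h using 2 with x hx y hy
  · rw [← card_neighborFinset_eq_degree]
    congr 1
    ext y
    have := @IsIndepSet.neighborFinset_subset_compl _ _ _ _ _ _ hS x hx y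
    simp [Finset.mem_bipartiteAbove] at this ⊢
    tauto
  · congr 1
    ext x
    simp [Finset.mem_bipartiteBelow, G.adj_comm, and_comm]

theorem IsIndepSet.sum_degree_le_sum_degree_compl (hS : G.IsIndepSet (S : Set V)) :
    ∑ x ∈ S, G.degree x ≤ ∑ y ∈ Sᶜ, G.degree y := by
  rw [hS.sum_degree_eq]
  exact Finset.sum_le_sum fun y _ => Finset.card_le_card Finset.inter_subset_left

/-- For an independent set meeting half of the degree sum, the complement is independent too. -/
theorem IsIndepSet.compl_of_sum_degree_eq (hS : G.IsIndepSet (S : Set V))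
    (h : ∑ x ∈ S, G.degree x = ∑ y ∈ Sᶜ, G.degree y) {y z : V} (hy : y ∉ S)
    (hyz : G.Adj y z) : z ∈ S := by
  rw [hS.sum_degree_eq] at h
  have h' := (Finset.sum_eq_sum_iff_of_le fun y _ =>
    Finset.card_le_card (Finset.inter_subset_left (s₁ := G.neighborFinset y) (s₂ := S))).mp h y
      (Finset.mem_compl.mpr hy)
  have := Finset.eq_of_subset_of_card_le Finset.inter_subset_left h'.ge
  exact (Finset.mem_inter.mp (this ▸ (G.mem_neighborFinset y z).mpr hyz)).2

theorem IsIndepSet.adj_of_degree_eq_card_compl (hS : G.IsIndepSet (S : Set V)) {x y : V}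
    (hx : x ∈ S) (hy : y ∉ S) (h : G.degree x = Sᶜ.card) : G.Adj x y := by
  have := Finset.eq_of_subset_of_card_le (hS.neighborFinset_subset_compl hx) h.ge
  rw [← mem_neighborFinset, this]
  exact Finset.mem_compl.mpr hy

end BipartiteCount

/-! ### Complete bipartite graphs -/

/-- A graph whose edges are all the pairs separated by `S` is complete bipartite. -/
theorem nonempty_iso_completeBipartiteGraph [Fintype V] [DecidableEq V] {S : Finset V} {a b : ℕ}
    (hadj : ∀ x y, G.Adj x y ↔ (x ∈ S ↔ y ∉ S)) (ha : Sᶜ.card = a) (hb : S.card = b) :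
    Nonempty (G ≃g completeBipartiteGraph (Fin a) (Fin b)) := by
  have e1 : Fin a ≃ {x // x ∉ S} := (Fintype.equivFinOfCardEq (by
    rw [← ha, Fintype.card_subtype_compl, Finset.card_compl, Fintype.card_coe])).symm
  have e2 : Fin b ≃ {x // x ∈ S} := (Fintype.equivFinOfCardEq (by
    rw [← hb, Fintype.card_coe])).symm
  let f : Fin a ⊕ Fin b ≃ V :=
    ((Equiv.sumComm _ _).trans (Equiv.sumCongr e2 e1)).trans (Equiv.sumCompl (· ∈ S))
  have fl : ∀ i, f (Sum.inl i) ∉ S := fun i => (e1 i).2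
  have fr : ∀ i, f (Sum.inr i) ∈ S := fun i => (e2 i).2
  refine ⟨Iso.symm ⟨f, ?_⟩⟩
  rintro (i | i) (j | j) <;> simp [hadj, fl, fr]

/-- A deleted set smaller than both sides misses some `s` and `t` on opposite sides; they are
adjacent, and every vertex is adjacent to one of them. -/
theorem isKConnected_of_adj_iff [Fintype V] [DecidableEq V] {S : Finset V} {m : ℕ} (hm : 0 < m)
    (hadj : ∀ x y, G.Adj x y ↔ (x ∈ S ↔ y ∉ S)) (h1 : m ≤ S.card) (h2 : m ≤ Sᶜ.card) :
    G.IsKConnected m := by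
  refine ⟨?_, fun X hX => ?_⟩
  · have := S.card_add_card_compl
    omega
  obtain ⟨s, hs, hsX⟩ := Finset.exists_mem_notMem_of_card_lt_card (lt_of_lt_of_le hX h1)
  obtain ⟨t, ht, htX⟩ := Finset.exists_mem_notMem_of_card_lt_card (lt_of_lt_of_le hX h2)
  rw [Finset.mem_compl] at ht
  let s' : ((X : Set V)ᶜ : Set V) := ⟨s, by simpa using hsX⟩
  let t' : ((X : Set V)ᶜ : Set V) := ⟨t, by simpa using htX⟩
  have hst : (G.induce ((X : Set V)ᶜ)).Adj s' t' := (hadj s t).mpr (by simp [hs, ht])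
  rw [connected_iff_exists_forall_reachable]
  refine ⟨s', fun w => ?_⟩
  by_cases hw : (w : V) ∈ S
  · have : (G.induce ((X : Set V)ᶜ)).Adj t' w := (hadj t w).mpr (by simp [hw, ht])
    exact hst.reachable.trans this.reachable
  · have : (G.induce ((X : Set V)ᶜ)).Adj s' w := (hadj s w).mpr (by simp [hw, hs])
    exact this.reachable

/-- Balanced complete bipartite graphs are Hamiltonian. -/
theorem isHamiltonian_of_adj_iff [Fintype V] [DecidableEq V] {S : Finset V} {m : ℕ} (hm : 2 ≤ m)
    (hadj : ∀ x y, G.Adj x y ↔ (x ∈ S ↔ y ∉ S)) (h1 : S.card = m) (h2 : Sᶜ.card = m) :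
    G.IsHamiltonian := by
  by_contra hG
  have hc := S.card_add_card_compl
  obtain ⟨I, hI, hind⟩ := (isKConnected_of_adj_iff (by omega) hadj h1.ge h2.ge
    ).exists_isIndepSet_of_not_isHamiltonian (by omega) (by omega) hG
  -- With `m + 1` vertices, `I` meets both sides and so contains an edge.
  obtain ⟨s, hs, hsS⟩ := Finset.exists_mem_notMem_of_card_lt_card (s := Sᶜ) (t := I) (by omega)
  obtain ⟨t, ht, htS⟩ := Finset.exists_mem_notMem_of_card_lt_card (s := S) (t := I) (by omega)
  rw [Finset.mem_compl, not_not] at hsS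
  have hst : G.Adj s t := (hadj s t).mpr (by simp [hsS, htS])
  exact hind hs ht hst.ne hst

end SimpleGraph

/-! ### Inequalities and the equality case -/

/-- A Pólya–Szegő type inequality: numbers in `[a, b]` satisfy
`∑ d ^ 2 + #S * (a * b) ≤ (a + b) * ∑ d`. -/
theorem Finset.sum_sq_add_card_mul_le {ι : Type*} (S : Finset ι) (d : ι → ℕ) {a b : ℕ}
    (ha : ∀ i ∈ S, a ≤ d i) (hb : ∀ i ∈ S, d i ≤ b) :
    ∑ i ∈ S, d i ^ 2 + S.card * (a * b) ≤ (a + b) * ∑ i ∈ S, d i := by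
  rw [← smul_eq_mul, ← Finset.sum_const, ← Finset.sum_add_distrib, Finset.mul_sum]
  refine Finset.sum_le_sum fun i hi => ?_
  have h1 := ha i hi
  have h2 := hb i hi
  zify at h1 h2 ⊢
  nlinarith [mul_nonneg (sub_nonneg.mpr h1) (sub_nonneg.mpr h2)]

/-- The equality case forced by comparing the hypothesis on the Zagreb index with the upper
bounds on its two parts. Here `Q`, `R` are the sums of squared degrees, `D` is a degree sum,
`c = #S * (δ * N)`, `p = δ + N` and `U` bounds `R`. -/
theorem eq_of_add_sq_div_le {Q R D e c p U : ℝ} (hc : 0 < c) (hp : 0 < p) (hQ : 0 ≤ Q)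
    (hDe : D ≤ e) (hR : R ≤ U) (hQD : Q + c ≤ p * D)
    (h : U + (e * p) ^ 2 / (4 * c) ≤ Q + R) : D = e ∧ Q = c ∧ R = U := by
  have h1 : (e * p) ^ 2 / (4 * c) ≤ Q := by linarith
  rw [div_le_iff₀ (by positivity)] at h1
  have h2 : p * D ≤ e * p := by nlinarith
  have h3 : (Q + c) ^ 2 ≤ (e * p) ^ 2 := pow_le_pow_left₀ (by positivity) (by linarith) 2
  -- `(Q + c)² ≤ (e * p)² ≤ 4cQ`, the reverse of AM-GM.
  have hQc : Q = c := by
    have : (Q - c) ^ 2 ≤ 0 := by nlinarith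
    nlinarith [pow_eq_zero_iff (two_ne_zero) |>.mp (le_antisymm this (sq_nonneg _))]
  subst hQc
  have h4 : e * p ≤ 2 * Q := by
    refine le_of_sq_le_sq ?_ (by positivity)
    nlinarith
  have h5 : D = e := by
    have : p * (e - D) ≤ 0 := by nlinarith
    nlinarith [nonneg_of_mul_nonneg_right (a := p) (b := D - e) (by nlinarith) hp]
  refine ⟨h5, rfl, le_antisymm hR ?_⟩
  have h6 : (e * p) ^ 2 / (4 * Q) = Q := by
    have : e * p = 2 * Q := le_antisymm h4 (by linarith)
    rw [this]
    field_simp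
    norm_num
  linarith

/-! ### The main theorem -/

theorem theorem1 {V : Type*} [Fintype V] [DecidableEq V] (G : SimpleGraph V)
    [DecidableRel G.Adj] (k n e : ℕ) (hk : 2 ≤ k) (hn : 3 ≤ n)
    (hcard : Fintype.card V = n) (hedges : G.edgeFinset.card = e)
    (hconn : G.IsKConnected k)
    (hM : ((n : ℝ) - k - 1) * (G.maxDegree : ℝ) ^ 2
        + ((e : ℝ) * ((G.minDegree : ℝ) + n - k - 1)) ^ 2
          / (4 * (G.minDegree : ℝ) * ((n : ℝ) - k - 1) * ((k : ℝ) + 1))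
        ≤ (G.firstZagrebIndex : ℝ)) :
    G.IsHamiltonian ∨
      Nonempty (G ≃g completeBipartiteGraph (Fin k) (Fin (k + 1))) := by
  rw [or_iff_not_imp_left]
  intro hG
  obtain ⟨S, hScard, hS⟩ := hconn.exists_isIndepSet_of_not_isHamiltonian (by omega) (by omega) hG
  obtain ⟨N, hN⟩ : ∃ N, Sᶜ.card = N := ⟨_, rfl⟩
  have hcc := S.card_add_card_compl
  rw [hN, hScard, hcard] at hcc
  have : Nonempty V := Fintype.card_pos_iff.mp (by omega)
  have hkδ : k ≤ G.minDegree := G.le_minDegree_of_forall_le_degree k fun v => hconn.le_degree v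
  have hdN : ∀ x ∈ S, G.degree x ≤ N := fun x hx => hN ▸ hS.degree_le_card_compl hx
  obtain ⟨s, hs⟩ : S.Nonempty := Finset.card_pos.mp (by omega)
  -- Hence `N > 0`: the degenerate case `n = k + 1` does not survive `hG`.
  have hkN : k ≤ N := hkδ.trans ((G.minDegree_le_degree s).trans (hdN s hs))
  have hsum : ∑ x ∈ S, G.degree x + ∑ y ∈ Sᶜ, G.degree y = 2 * e := by
    rw [Finset.sum_add_sum_compl, G.sum_degrees_eq_twice_card_edges, hedges]
  have hle := hS.sum_degree_le_sum_degree_compl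
  have hsq : ∑ x ∈ S, G.degree x ^ 2 + ∑ y ∈ Sᶜ, G.degree y ^ 2 = G.firstZagrebIndex :=
    Finset.sum_add_sum_compl _ _
  have hΔ : ∀ y ∈ Sᶜ, G.degree y ^ 2 ≤ G.maxDegree ^ 2 := fun y _ =>
    Nat.pow_le_pow_left (G.degree_le_maxDegree y) 2
  have hR : ∑ y ∈ Sᶜ, G.degree y ^ 2 ≤ N * G.maxDegree ^ 2 := by
    rw [← hN, ← smul_eq_mul]
    exact Finset.sum_le_card_nsmul _ _ _ hΔ
  have hQ := S.sum_sq_add_card_mul_le (fun v => G.degree v) (fun x _ => G.minDegree_le_degree x) hdN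
  rw [hScard] at hQ
  obtain ⟨hDe, hQc, hRU⟩ : ∑ x ∈ S, G.degree x = e ∧
      ∑ x ∈ S, G.degree x ^ 2 = (k + 1) * (G.minDegree * N) ∧
      ∑ y ∈ Sᶜ, G.degree y ^ 2 = N * G.maxDegree ^ 2 := by
    have hδ0 : 0 < G.minDegree := by omega
    have hN0 : 0 < N := by omega
    have hnN : (n : ℝ) = k + 1 + N := by exact_mod_cast hcc.symm
    have key := eq_of_add_sq_div_le
      (Q := (∑ x ∈ S, G.degree x ^ 2 : ℕ)) (R := (∑ y ∈ Sᶜ, G.degree y ^ 2 : ℕ))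
      (D := (∑ x ∈ S, G.degree x : ℕ)) (e := e) (c := ((k + 1) * (G.minDegree * N) : ℕ))
      (p := (G.minDegree + N : ℕ)) (U := (N * G.maxDegree ^ 2 : ℕ))
      (by exact_mod_cast (by positivity)) (by exact_mod_cast (by positivity))
      (by positivity) (by exact_mod_cast (by omega)) (by exact_mod_cast hR)
      (by exact_mod_cast hQ) (by
        rw [← Nat.cast_add (∑ x ∈ S, G.degree x ^ 2), hsq]
        refine le_trans (le_of_eq ?_) hM
        rw [hnN]
        push_cast
        congr 1
        · ring
        · congr 1 <;> ring)
    exact_mod_cast key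
  have hTΔ : ∀ y ∈ Sᶜ, G.degree y = G.maxDegree := by
    intro y hy
    have h := (Finset.sum_eq_sum_iff_of_le hΔ).mp (by simp [hRU, hN]) y hy
    exact Nat.pow_left_injective two_ne_zero h
  have hTe : N * G.maxDegree = e := by
    have : ∑ y ∈ Sᶜ, G.degree y = N * G.maxDegree := by
      rw [Finset.sum_congr rfl hTΔ, Finset.sum_const, hN, smul_eq_mul]
    omega
  have hΔ0 : 0 < G.maxDegree := by
    have := G.minDegree_le_maxDegree
    omega
  have hSΔ : ∀ x ∈ S, G.degree x ≤ G.maxDegree := fun x _ => G.degree_le_maxDegree x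
  -- `NΔ = e = ∑_S d ≤ (k + 1)Δ`.
  have hNk : N ≤ k + 1 := by
    have h := Finset.sum_le_card_nsmul _ _ _ hSΔ
    rw [hDe, ← hTe, hScard, smul_eq_mul] at h
    exact Nat.le_of_mul_le_mul_right h hΔ0
  have hSN : ∀ x ∈ S, G.degree x = N := by
    intro x hx
    -- If `N = k`, then `k ≤ δ ≤ d ≤ N` settles it. If `N = k + 1`, the graph is `Δ`-regular and `Q
    -- = c` reads `(k + 1)Δ² = (k + 1)ΔN`.
    rcases hNk.lt_or_eq with hlt | hNk
    · have := hdN x hx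
      have := G.minDegree_le_degree x
      omega
    · have hSd : ∀ x ∈ S, G.degree x = G.maxDegree :=
        (Finset.sum_eq_sum_iff_of_le hSΔ).mp (by simp [hDe, hScard, ← hTe, hNk])
      have hreg : ∀ v, G.degree v = G.maxDegree := fun v => by
        by_cases hv : v ∈ S
        · exact hSd v hv
        · exact hTΔ v (Finset.mem_compl.mpr hv)
      obtain ⟨v, hv⟩ := G.exists_minimal_degree_vertex
      rw [Finset.sum_congr rfl fun x hx => by rw [hSd x hx], Finset.sum_const, hScard, hv, hreg v,
        smul_eq_mul, sq] at hQc
      rw [hSd x hx]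
      exact Nat.eq_of_mul_eq_mul_left hΔ0 (Nat.eq_of_mul_eq_mul_left (Nat.succ_pos k) hQc)
  have hadj : ∀ x y, G.Adj x y ↔ (x ∈ S ↔ y ∉ S) := by
    intro x y
    by_cases hx : x ∈ S <;> by_cases hy : y ∈ S
    · simpa [hx, hy] using fun h : G.Adj x y => hS hx hy h.ne h
    · simpa [hx, hy] using hS.adj_of_degree_eq_card_compl hx hy (by rw [hN, hSN x hx])
    · simpa [hx, hy] using (hS.adj_of_degree_eq_card_compl hy hx (by rw [hN, hSN y hy])).symm
    -- As `D = e` is half the degree sum, no edge lies outside `S`.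
    · simpa [hx, hy] using fun h : G.Adj x y => hy (hS.compl_of_sum_degree_eq (by omega) hx h)
  rcases hNk.lt_or_eq with hlt | hNk
  · exact SimpleGraph.nonempty_iso_completeBipartiteGraph hadj (by omega) hScard
  · exact absurd (SimpleGraph.isHamiltonian_of_adj_iff (by omega) hadj hScard (by omega)) hG
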